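/- Let $r \ge 2$ and let $\mathcal{R}_r$ be the $r$-rose (one vertex, $r$ loop edges). A length function on $\mathcal{R}_r$ is a point $\ell = (\ell^1,\dots,\ell^r) \in (0,\infty)^r$, where $\ell^k$ is the length of the $k$-th edge in either direction. A based circuit is a nonempty sequence $\gamma=(e_1,\dots,e_n)$ of directed edges, with $\tau(e_k)=o(e_{k+1})$ for $k<n$ and $\tau(e_n)=o(e_1)$ (where $o$, $\tau$ denote originating and terminating vertices), such that $e_k \ne \bar e_{k+1}$ for $k<n$ and $e_n \neq \bar e_1$ (where $\bar e$ is $e$ reversed); its length $\ell(\gamma)$ is the sum of the lengths of its edges. The entropy of $\ell$ is $$\mathfrak{h}(\ell) = \lim_{t\to\infty} \frac1t \log \bigl|\{\gamma \text{ a based circuit} : \ell(\gamma)\le t\}\bigr| .$$ Let $\mathcal{M}^1(\mathcal{R}_r) = \{\ell \in (0,\infty)^r : \mathfrak{h}(\ell)=1\}$. The entropy metric on $\mathcal{M}^1(\mathcal{R}_r)$ is the Riemannian metric $\langle v,w\rangle_{\mathfrak h} = \langle v, \mathbf{H}[\mathfrak{h}(\ell)]\, w\rangle$ for tangent vectors $v,w$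 at $\ell$, where $\mathbf{H}$ denotes the Hessian matrix, and $d_{\mathfrak{h}}(x,y)$ is the infimum of the lengths, in this metric, of piecewise smooth paths in $\mathcal{M}^1(\mathcal{R}_r)$ from $x$ to $y$. For $i\in\{1,\dots,r\}$ and $\epsilon>0$ let $$\mathcal{S}^i_\epsilon = \{\ell \in \mathcal{M}^1(\mathcal{R}_r) : \ell^i = \epsilon\}.$$ Proposition 8.9. Let $r\ge 2$ and $i \in \{1,\dots,r\}$. Then $$\lim_{\epsilon\to 0^+} \operatorname{diam}(\mathcal{S}^i_\epsilon) = 0,$$ where the diameter is taken with respect to $d_{\mathfrak{h}}$. -/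

import Mathlib

open Set Filter Topology MeasureTheory
open scoped ContDiff ENNReal

/-- A graph with vertex set `V`, given by its set `E` of positively oriented edges together with
the originating and terminating vertex of each of them.  (Loops and multiple edges are allowed.) -/
structure OrientedGraph (V E : Type*) where
  o : E → V
  τ : E → V

namespace OrientedGraph

variable {V E : Type*}

/-- Directed edges: two copies of every edge; `(e, true)` is `e` with its given orientation and
`(e, false)` is the same edge traversed backwards. -/
abbrev DirEdge (_G : OrientedGraph V E) : Type _ := E × Bool

/-- The originating vertex of a directed edge. -/
def orig (G : OrientedGraph V E) (e : G.DirEdge) : V := if e.2 then G.o e.1 else G.τ e.1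

/-- The terminating vertex of a directed edge. -/
def term (G : OrientedGraph V E) (e : G.DirEdge) : V := if e.2 then G.τ e.1 else G.o e.1

/-- The fixed point free involution reversing a directed edge. -/
def rev (G : OrientedGraph V E) (e : G.DirEdge) : G.DirEdge := (e.1, !e.2)

/-- A reduced edge path: consecutive edges match up and there is no backtracking. -/
def IsReducedPath (G : OrientedGraph V E) (γ : List G.DirEdge) : Prop :=
  γ.IsChain (fun a b => G.term a = G.orig b ∧ a ≠ G.rev b)

/-- A based circuit: a (nonempty) reduced edge path `(e₁, …, eₙ)` with `τ(eₙ) = o(e₁)` such that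
`eₙ` is not the reverse of `e₁`. -/
def IsBasedCircuit (G : OrientedGraph V E) (γ : List G.DirEdge) : Prop :=
  G.IsReducedPath γ ∧
    ∃ h : γ ≠ [], G.term (γ.getLast h) = G.orig (γ.head h) ∧ γ.getLast h ≠ G.rev (γ.head h)

/-- The length of an edge path; both orientations of an edge have the same length. -/
def pathLength (G : OrientedGraph V E) (ℓ : E → ℝ) (γ : List G.DirEdge) : ℝ :=
  (γ.map (fun e => ℓ e.1)).sum

/-- The based circuits of length at most `t`. -/
def circuitsUpTo (G : OrientedGraph V E) (ℓ : E → ℝ) (t : ℝ) : Set (List G.DirEdge) :=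
  {γ | G.IsBasedCircuit γ ∧ G.pathLength ℓ γ ≤ t}

/-- The entropy of a length function: the exponential growth rate of the number of based circuits,
`lim_{t → ∞} (1/t) log |{γ : ℓ(γ) ≤ t}|`. -/
noncomputable def entropy (G : OrientedGraph V E) (ℓ : E → ℝ) : ℝ :=
  limUnder atTop (fun t : ℝ => (1 / t) * Real.log ((G.circuitsUpTo ℓ t).ncard : ℝ))

/-- The length functions on the graph: all edges have positive length. -/
def lengthFunctions (_G : OrientedGraph V E) : Set (E → ℝ) := {ℓ | ∀ e, 0 < ℓ e}

/-- The moduli space of unit entropy length functions. -/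
def unitEntropy (G : OrientedGraph V E) : Set (E → ℝ) :=
  {ℓ | ℓ ∈ G.lengthFunctions ∧ G.entropy ℓ = 1}

variable [Fintype E]

/-- The entropy metric: the Hessian (second derivative) of the entropy function at `ℓ`, as a
bilinear form.  It is applied to vectors tangent to the space of unit entropy length functions. -/
noncomputable def entropyInner (G : OrientedGraph V E) (ℓ v w : E → ℝ) : ℝ :=
  fderiv ℝ (fderiv ℝ G.entropy) ℓ v w

/-- The norm of a tangent vector in the entropy metric. -/
noncomputable def entropyNorm (G : OrientedGraph V E) (ℓ v : E → ℝ) : ℝ :=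
  Real.sqrt (G.entropyInner ℓ v v)

/-- `c` restricted to `[0,1]` is a piecewise smooth path in the space of unit entropy length
functions: it is continuous, stays in that space, and is smooth (up to the end points) on each of
the finitely many closed intervals of some subdivision of `[0,1]`. -/
structure IsPath (G : OrientedGraph V E) (c : ℝ → E → ℝ) : Prop where
  continuousOn : ContinuousOn c (Icc 0 1)
  mem : ∀ t ∈ Icc (0 : ℝ) 1, c t ∈ G.unitEntropy
  piecewise_smooth : ∃ (n : ℕ) (s : ℕ → ℝ), s 0 = 0 ∧ s n = 1 ∧
    ∀ k < n, s k < s (k + 1) ∧ ContDiffOn ℝ ∞ c (Icc (s k) (s (k + 1)))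

/-- The length of a path in the entropy metric: the integral over `[0,1]` of the norm of its
velocity (which is defined away from the finitely many break points). -/
noncomputable def entropyLength (G : OrientedGraph V E) (c : ℝ → E → ℝ) : ℝ≥0∞ :=
  ∫⁻ t in Icc (0 : ℝ) 1, ENNReal.ofReal (G.entropyNorm (c t) (deriv c t))

/-- The entropy distance: the infimum of the lengths of the piecewise smooth paths in the space of
unit entropy length functions that join `x` to `y` (and `∞` if there were none). -/
noncomputable def entropyDist (G : OrientedGraph V E) (x y : E → ℝ) : ℝ≥0∞ :=
  ⨅ (c : ℝ → E → ℝ) (_ : G.IsPath c ∧ c 0 = x ∧ c 1 = y), G.entropyLength c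

/-- The diameter of a set of unit entropy length functions in the entropy distance. -/
noncomputable def entropyDiam (G : OrientedGraph V E) (S : Set (E → ℝ)) : ℝ≥0∞ :=
  ⨆ x ∈ S, ⨆ y ∈ S, G.entropyDist x y

end OrientedGraph

/-- The `r`-rose: one vertex and `r` loops. -/
def rose (r : ℕ) : OrientedGraph Unit (Fin r) where
  o := fun _ => ()
  τ := fun _ => ()

/-- The slice of the unit entropy moduli space of the `r`-rose on which the `i`-th edge has
length `ε`. -/
def roseSlice (r : ℕ) (i : Fin r) (ε : ℝ) : Set (Fin r → ℝ) :=
  {ℓ | ℓ ∈ (rose r).unitEntropy ∧ ℓ i = ε}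

/-! Put weight `a k = fermi (h * ℓ k)` on both orientations of edge `k`. When the weights of all
directed edges sum to 1, the edges allowed after `e` have total weight `1 - a = exp (h * ℓ e) * a`
(`sum_fermi_ne_rev`): the weights form a positive eigenvector for extending reduced paths. Hence
circuits of length at most `t` number `exp (h * t)` up to a constant below and a linear factor
above, and `h` is the entropy (`rose_entropy_eq`).

In the coordinates `a k = fermi (ℓ k)` the unit entropy space is therefore the open simplex `∑ a k =
1/2`, and any two points are joined by a straight segment, with constant velocity `Δ k`. Since
entropy is constant along it, its Hessian on the velocity is minus its differential on the
acceleration, so the squared speed is at most `(∑ Δ k ^ 2 / a k) / roseDenom`.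

On the slice `ℓ i = ε`, `Δ i = 0` and the other weights sum to `δ = 1/2 - fermi ε`. They are at most
`δ`, so the corresponding lengths are at least `logit δ`, and `roseDenom ≥ δ * logit δ / 2`. As `|Δ
k| / √(a k)` integrates to at most `2 * √δ`, the factor `√δ` cancels and the length is at most `2 *
r / √(logit δ / 2)`, which tends to 0 because `δ → 0`. -/

/-- The logistic weight `1 / (1 + e^u)`. -/
noncomputable def fermi (u : ℝ) : ℝ := 1 / (1 + Real.exp u)

/-- The sum of the logistic weights of the edges of the rose, rescaled by `h`; the entropy is the
value of `h` at which it equals `1 / 2`. -/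
noncomputable def roseSum {r : ℕ} (p : (Fin r → ℝ) × ℝ) : ℝ := ∑ k, fermi (p.2 * p.1 k)

/-! ### Counting circuits and the entropy equation -/

lemma fermi_pos (u : ℝ) : 0 < fermi u := by unfold fermi; positivity

lemma one_sub_fermi (u : ℝ) : 1 - fermi u = Real.exp u * fermi u := by
  unfold fermi; field_simp; ring

lemma fermi_mul_exp_le_one {u s : ℝ} (h : s ≤ u) : fermi u * Real.exp s ≤ 1 := by
  unfold fermi
  have := Real.exp_le_exp.2 h
  rw [one_div, inv_mul_le_iff₀ (by positivity)]
  linarith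

/-- The factor 2 comes from `1 + exp u ≤ 2 * exp u` for `u ≥ 0`; it is the constant in the upper
path count. -/
lemma one_le_two_mul_fermi_mul_exp {u s : ℝ} (hu : 0 ≤ u) (h : u ≤ s) :
    1 ≤ 2 * fermi u * Real.exp s := by
  unfold fermi
  have h1 := Real.exp_le_exp.2 h
  have h2 := Real.one_le_exp hu
  rw [mul_one_div, div_mul_eq_mul_div, le_div_iff₀ (by positivity)]
  linarith

namespace OrientedGraph

lemma pathLength_cons {V E : Type*} (G : OrientedGraph V E) (ℓ : E → ℝ) (e : G.DirEdge)
    (γ : List G.DirEdge) : G.pathLength ℓ (e :: γ) = ℓ e.1 + G.pathLength ℓ γ := by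
  simp [pathLength]

lemma mul_length_le_pathLength {V E : Type*} (G : OrientedGraph V E) (ℓ : E → ℝ) {m : ℝ}
    (hm : ∀ k, m ≤ ℓ k) (γ : List G.DirEdge) : m * γ.length ≤ G.pathLength ℓ γ := by
  induction γ with
  | nil => simp [pathLength]
  | cons e γ ih =>
    rw [pathLength_cons, List.length_cons]
    push_cast
    have := hm e.1
    nlinarith

end OrientedGraph

variable {r : ℕ}

lemma rose_isReducedPath_cons_cons (e f : (rose r).DirEdge) (γ : List (rose r).DirEdge) :
    (rose r).IsReducedPath (e :: f :: γ) ↔ f ≠ (rose r).rev e ∧ (rose r).IsReducedPath (f :: γ) := by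
  unfold OrientedGraph.IsReducedPath
  rw [List.isChain_cons_cons]
  have : (e ≠ (rose r).rev f) ↔ f ≠ (rose r).rev e := by
    rcases e with ⟨a, b⟩; rcases f with ⟨c, d⟩
    cases b <;> cases d <;> simp [OrientedGraph.rev, eq_comm]
  rw [this]
  simp

lemma sum_fermi_dirEdge {ℓ : Fin r → ℝ} {h : ℝ} (hs : roseSum (ℓ, h) = 1 / 2) :
    ∑ f : (rose r).DirEdge, fermi (h * ℓ f.1) = 1 := by
  rw [Fintype.sum_prod_type]
  simp only [Finset.sum_const, Finset.card_univ, Fintype.card_bool, nsmul_eq_mul]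
  rw [← Finset.mul_sum]
  unfold roseSum at hs
  simp only at hs
  rw [hs]; norm_num

/-- An edge and its reverse have equal weight, so removing the reverse from the total 1 leaves `1 -
fermi`. This eigenvector relation drives both path counts. -/
lemma sum_fermi_ne_rev {ℓ : Fin r → ℝ} {h : ℝ} (hs : roseSum (ℓ, h) = 1 / 2)
    (e : (rose r).DirEdge) :
    ∑ f ∈ Finset.univ.erase ((rose r).rev e), fermi (h * ℓ f.1)
      = Real.exp (h * ℓ e.1) * fermi (h * ℓ e.1) := by
  rw [← one_sub_fermi, ← sum_fermi_dirEdge hs, ← Finset.sum_erase_add _ _ (Finset.mem_univ ((rose r).rev e))]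
  simp [OrientedGraph.rev]

/-- Many reduced paths start with a given edge and are not too long. -/
lemma exists_many_reduced_paths {ℓ : Fin r → ℝ} {h m M : ℝ} (hh : 0 < h)
    (hml : ∀ k, m ≤ ℓ k) (hM : ∀ k, ℓ k ≤ M) (hs : roseSum (ℓ, h) = 1 / 2) (n : ℕ) :
    ∀ (e : (rose r).DirEdge) (s : ℝ), 0 ≤ s → s < n * m →
      ∃ T : Finset (List (rose r).DirEdge),
        (∀ γ ∈ T, (rose r).IsReducedPath (e :: γ) ∧ (rose r).pathLength ℓ (e :: γ) ≤ s + M) ∧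
        fermi (h * ℓ e.1) * Real.exp (h * s) ≤ T.card := by
  induction n with
  | zero => intro e s h0 h1; simp at h1; linarith
  | succ n ih =>
    intro e s h0 h1
    -- Stop as soon as the current edge exceeds the remaining budget `s`; the overshoot is at most
    -- `M`. Otherwise the edge uses up at least `m`, so `n` bounds the depth of the recursion.
    rcases lt_or_ge s (ℓ e.1) with hlt | hge
    · refine ⟨{[]}, ?_, ?_⟩
      · intro γ hγ
        simp only [Finset.mem_singleton] at hγ
        subst hγ
        refine ⟨by simp [OrientedGraph.IsReducedPath], ?_⟩
        have := hM e.1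
        simp [OrientedGraph.pathLength]
        linarith
      · simpa using fermi_mul_exp_le_one (mul_le_mul_of_nonneg_left hlt.le hh.le)
    · have key : ∀ f : (rose r).DirEdge, ∃ T : Finset (List (rose r).DirEdge),
          (∀ γ ∈ T, (rose r).IsReducedPath (f :: γ) ∧
            (rose r).pathLength ℓ (f :: γ) ≤ (s - ℓ e.1) + M) ∧
          fermi (h * ℓ f.1) * Real.exp (h * (s - ℓ e.1)) ≤ T.card := fun f =>
        ih f _ (by linarith) (by have := hml e.1; push_cast at h1; linarith)
      choose T hT1 hT2 using key
      classical
      refine ⟨(Finset.univ.erase ((rose r).rev e)).biUnion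
        fun f => (T f).image (List.cons f), ?_, ?_⟩
      · intro γ hγ
        simp only [Finset.mem_biUnion, Finset.mem_image] at hγ
        obtain ⟨f, hf, γ', hγ', rfl⟩ := hγ
        obtain ⟨h2, h3⟩ := hT1 f γ' hγ'
        refine ⟨(rose_isReducedPath_cons_cons _ _ _).2 ⟨Finset.ne_of_mem_erase hf, h2⟩, ?_⟩
        rw [OrientedGraph.pathLength_cons]
        linarith
      · rw [Finset.card_biUnion]
        · push_cast
          calc fermi (h * ℓ e.1) * Real.exp (h * s)
              = ∑ f ∈ Finset.univ.erase ((rose r).rev e),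
                  fermi (h * ℓ f.1) * Real.exp (h * (s - ℓ e.1)) := by
                rw [← Finset.sum_mul, sum_fermi_ne_rev hs, mul_sub, Real.exp_sub]
                field_simp
            _ ≤ _ := by
                refine Finset.sum_le_sum fun f _ => ?_
                rw [Finset.card_image_of_injective _ List.cons_injective]
                exact hT2 f
        · intro f _ g _ hfg
          refine Finset.disjoint_left.2 fun γ h2 h3 => ?_
          simp only [Finset.mem_image] at h2 h3
          obtain ⟨a, _, rfl⟩ := h2
          obtain ⟨b, _, hb⟩ := h3
          exact hfg (List.cons.inj hb).1.symm

/-- Not too many reduced paths with a given number of edges start with a given edge. -/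
lemma card_reduced_paths_le {ℓ : Fin r → ℝ} {h : ℝ} (hh : 0 < h)
    (hl : ∀ k, 0 < ℓ k) (hs : roseSum (ℓ, h) = 1 / 2) (n : ℕ) :
    ∀ (e : (rose r).DirEdge) (t : ℝ) (T : Finset (List (rose r).DirEdge)),
      (∀ γ ∈ T, γ.length = n ∧ (rose r).IsReducedPath (e :: γ) ∧
        (rose r).pathLength ℓ (e :: γ) ≤ t) →
      (T.card : ℝ) ≤ 2 * fermi (h * ℓ e.1) * Real.exp (h * t) := by
  induction n with
  | zero =>
    intro e t T hT
    rcases T.eq_empty_or_nonempty with rfl | ⟨γ, hγ⟩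
    · simpa using (by have := fermi_pos (h * ℓ e.1); positivity :
        0 ≤ 2 * fermi (h * ℓ e.1) * Real.exp (h * t))
    · have h1 : T ⊆ {[]} := fun γ hγ => by
        simpa using List.length_eq_zero_iff.1 (hT γ hγ).1
      have h2 : (T.card : ℝ) ≤ 1 := by exact_mod_cast Finset.card_le_card h1
      refine h2.trans (one_le_two_mul_fermi_mul_exp (mul_pos hh (hl _)).le ?_)
      have h3 := (hT γ hγ).2.2
      rw [List.length_eq_zero_iff.1 (hT γ hγ).1, OrientedGraph.pathLength_cons] at h3
      simp only [OrientedGraph.pathLength, List.map_nil, List.sum_nil, add_zero] at h3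
      exact mul_le_mul_of_nonneg_left h3 hh.le
  | succ n ih =>
    intro e t T hT
    classical
    -- Sort the paths by their next edge; deleting the head then reduces to the induction hypothesis
    -- with budget `t - ℓ e`.
    have hsub : T ⊆ (Finset.univ.erase ((rose r).rev e)).biUnion
        fun f => (T.filter fun γ => γ.head? = some f) := by
      intro γ hγ
      obtain ⟨h1, h2, h3⟩ := hT γ hγ
      rcases γ with _ | ⟨f, γ⟩
      · simp at h1
      · simp only [Finset.mem_biUnion, Finset.mem_filter]
        exact ⟨f, Finset.mem_erase.2 ⟨((rose_isReducedPath_cons_cons _ _ _).1 h2).1,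
          Finset.mem_univ _⟩, hγ, rfl⟩
    have hcard : ∀ f : (rose r).DirEdge, ((T.filter fun γ => γ.head? = some f).card : ℝ)
        ≤ 2 * fermi (h * ℓ f.1) * Real.exp (h * (t - ℓ e.1)) := by
      intro f
      have hinj : Set.InjOn List.tail (↑(T.filter fun γ => γ.head? = some f) : Set (List (rose r).DirEdge)) := by
        intro a ha b hb hab
        simp only [Finset.coe_filter, Set.mem_ofPred_eq] at ha hb
        rcases a with _ | ⟨a1, a⟩
        · simp at ha
        rcases b with _ | ⟨b1, b⟩
        · simp at hb
        simp_all
      rw [← Finset.card_image_of_injOn hinj]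
      apply ih
      intro γ hγ
      simp only [Finset.mem_image, Finset.mem_filter] at hγ
      obtain ⟨a, ⟨ha, ha'⟩, rfl⟩ := hγ
      obtain ⟨h1, h2, h3⟩ := hT a ha
      rcases a with _ | ⟨a1, a⟩
      · simp at ha'
      simp only [List.head?_cons, Option.some.injEq] at ha'
      subst ha'
      rw [OrientedGraph.pathLength_cons] at h3
      exact ⟨by simpa using h1, ((rose_isReducedPath_cons_cons _ _ _).1 h2).2, by
        simp only [List.tail_cons]; linarith⟩
    calc (T.card : ℝ) ≤ ∑ f ∈ Finset.univ.erase ((rose r).rev e),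
          ((T.filter fun γ => γ.head? = some f).card : ℝ) := by
          exact_mod_cast (Finset.card_le_card hsub).trans Finset.card_biUnion_le
      _ ≤ ∑ f ∈ Finset.univ.erase ((rose r).rev e),
          2 * fermi (h * ℓ f.1) * Real.exp (h * (t - ℓ e.1)) :=
          Finset.sum_le_sum fun f _ => hcard f
      _ = _ := by
        rw [← Finset.sum_mul, ← Finset.mul_sum, sum_fermi_ne_rev hs, mul_sub, Real.exp_sub]
        field_simp

lemma finite_rose_circuitsUpTo {ℓ : Fin r → ℝ} {m : ℝ} (hm : 0 < m) (hml : ∀ k, m ≤ ℓ k) (t : ℝ) :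
    ((rose r).circuitsUpTo ℓ t).Finite := by
  refine (List.finite_length_le (rose r).DirEdge ⌊t / m⌋₊).subset fun γ hγ => ?_
  refine Nat.le_floor ?_
  rw [le_div_iff₀ hm, mul_comm]
  exact ((rose r).mul_length_le_pathLength ℓ hml γ).trans hγ.2

/-- A circuit has at most `t / m` edges. For each number of edges, summing the path bound over first
edges costs nothing, as the weights sum to 1. The resulting linear factor in `t` does not affect the
growth rate. -/
lemma ncard_rose_circuitsUpTo_le {ℓ : Fin r → ℝ} {h m : ℝ} (hh : 0 < h) (hm : 0 < m)
    (hml : ∀ k, m ≤ ℓ k) (hs : roseSum (ℓ, h) = 1 / 2) {t : ℝ} (ht : 1 ≤ t) :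
    (((rose r).circuitsUpTo ℓ t).ncard : ℝ)
      ≤ (2 * (1 / m + 1)) * t * Real.exp (h * t) := by
  classical
  have hfin := finite_rose_circuitsUpTo hm hml t
  set S := hfin.toFinset with hS
  rw [Set.ncard_eq_toFinset_card _ hfin, ← hS]
  have hmem : ∀ γ ∈ S, (rose r).IsBasedCircuit γ ∧ (rose r).pathLength ℓ γ ≤ t := fun γ hγ => by
    rw [hS, Set.Finite.mem_toFinset] at hγ; exact hγ
  set N := ⌊t / m⌋₊ with hN
  have hsub : S ⊆ (Finset.range N).biUnion fun n =>
      (Finset.univ : Finset (rose r).DirEdge).biUnion fun e =>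
        S.filter fun γ => γ.head? = some e ∧ γ.length = n + 1 := by
    intro γ hγ
    obtain ⟨h1, h2⟩ := hmem γ hγ
    have h3 := ((rose r).mul_length_le_pathLength ℓ hml γ).trans h2
    rcases γ with _ | ⟨e, γ⟩
    · obtain ⟨-, h4, -⟩ := h1
      exact absurd rfl h4
    · simp only [Finset.mem_biUnion, Finset.mem_filter, Finset.mem_range]
      refine ⟨γ.length, ?_, e, Finset.mem_univ _, hγ, rfl, rfl⟩
      have : (e :: γ).length ≤ N := Nat.le_floor (by rwa [le_div_iff₀ hm, mul_comm])
      simpa using this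
  have hcard : ∀ (n : ℕ) (e : (rose r).DirEdge),
      ((S.filter fun γ => γ.head? = some e ∧ γ.length = n + 1).card : ℝ)
        ≤ 2 * fermi (h * ℓ e.1) * Real.exp (h * t) := by
    intro n e
    have hinj : Set.InjOn List.tail (↑(S.filter fun γ => γ.head? = some e ∧ γ.length = n + 1) :
        Set (List (rose r).DirEdge)) := by
      intro a ha b hb hab
      simp only [Finset.coe_filter, Set.mem_ofPred_eq] at ha hb
      rcases a with _ | ⟨a1, a⟩
      · simp at ha
      rcases b with _ | ⟨b1, b⟩
      · simp at hb
      simp_all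
    rw [← Finset.card_image_of_injOn hinj]
    refine card_reduced_paths_le hh (fun k => hm.trans_le (hml k)) hs n e t _ ?_
    intro γ hγ
    simp only [Finset.mem_image, Finset.mem_filter] at hγ
    obtain ⟨a, ⟨ha, ha', ha''⟩, rfl⟩ := hγ
    obtain ⟨h1, h2⟩ := hmem a ha
    rcases a with _ | ⟨a1, a⟩
    · simp at ha'
    simp only [List.head?_cons, Option.some.injEq] at ha'
    subst ha'
    exact ⟨by simpa using ha'', h1.1, h2⟩
  have hNt : (N : ℝ) ≤ (1 / m + 1) * t := by
    have : (N : ℝ) ≤ t / m := Nat.floor_le (by positivity)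
    have h2 : t / m = 1 / m * t := by ring
    linarith
  calc (S.card : ℝ) ≤ ∑ n ∈ Finset.range N, ∑ e : (rose r).DirEdge,
          ((S.filter fun γ => γ.head? = some e ∧ γ.length = n + 1).card : ℝ) := by
        exact_mod_cast (Finset.card_le_card hsub).trans (Finset.card_biUnion_le.trans
          (Finset.sum_le_sum fun n _ => Finset.card_biUnion_le))
    _ ≤ ∑ n ∈ Finset.range N, ∑ e : (rose r).DirEdge,
          2 * fermi (h * ℓ e.1) * Real.exp (h * t) :=
        Finset.sum_le_sum fun n _ => Finset.sum_le_sum fun e _ => hcard n e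
    _ = N * (2 * Real.exp (h * t)) := by
        simp_rw [← Finset.sum_mul, ← Finset.mul_sum, sum_fermi_dirEdge hs]
        simp
        ring
    _ ≤ ((1 / m + 1) * t) * (2 * Real.exp (h * t)) := by gcongr
    _ = _ := by ring

lemma exists_ne_ne (hr : 2 ≤ r) (a b : (rose r).DirEdge) :
    ∃ f : (rose r).DirEdge, f ≠ a ∧ f ≠ b := by
  classical
  have : ({a, b} : Finset (rose r).DirEdge).card < (Finset.univ : Finset (rose r).DirEdge).card := by
    refine (Finset.card_le_two).trans_lt ?_
    rw [Finset.card_univ, Fintype.card_prod, Fintype.card_fin, Fintype.card_bool]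
    omega
  obtain ⟨f, -, hf⟩ := Finset.exists_mem_notMem_of_card_lt_card this
  simp only [Finset.mem_insert, Finset.mem_singleton, not_or] at hf
  exact ⟨f, hf⟩

/-- One extra edge closes a reduced path, provided it avoids the reverses of the first and last
edges; there are at least four directed edges to choose from. -/
lemma exists_isBasedCircuit_append (hr : 2 ≤ r) (e : (rose r).DirEdge)
    (γ : List (rose r).DirEdge) (hγ : (rose r).IsReducedPath (e :: γ)) :
    ∃ f : (rose r).DirEdge, (rose r).IsBasedCircuit (e :: γ ++ [f]) := by
  obtain ⟨f, h1, h2⟩ := exists_ne_ne hr ((rose r).rev e)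
    ((rose r).rev ((e :: γ).getLast (by simp)))
  refine ⟨f, ?_, by simp, ?_⟩
  · unfold OrientedGraph.IsReducedPath at hγ ⊢
    rw [List.isChain_append]
    refine ⟨hγ, by simp, ?_⟩
    intro x hx y hy
    simp only [List.head?_cons, Option.mem_def, Option.some.injEq] at hy
    subst hy
    rw [List.getLast?_eq_getLast_of_ne_nil (by simp), Option.mem_def, Option.some.injEq] at hx
    subst hx
    refine ⟨rfl, fun h3 => h2 ?_⟩
    rw [h3]
    simp [OrientedGraph.rev]
  · refine ⟨rfl, ?_⟩
    simpa using h1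

lemma le_ncard_rose_circuitsUpTo (hr : 2 ≤ r) {ℓ : Fin r → ℝ} {h m M : ℝ} (hh : 0 < h) (hm : 0 < m)
    (hml : ∀ k, m ≤ ℓ k) (hM : ∀ k, ℓ k ≤ M) (hs : roseSum (ℓ, h) = 1 / 2) (k : Fin r)
    {t : ℝ} (ht : 2 * M ≤ t) :
    fermi (h * ℓ k) * Real.exp (-(h * (2 * M))) * Real.exp (h * t)
      ≤ ((rose r).circuitsUpTo ℓ t).ncard := by
  classical
  obtain ⟨n, hn⟩ := exists_nat_gt ((t - 2 * M) / m)
  -- The budget leaves room for two lengths `M`: one for the overshoot of the path, one for the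
  -- closing edge.
  obtain ⟨T, hT1, hT2⟩ := exists_many_reduced_paths hh hml hM hs n (k, true) (t - 2 * M)
    (by linarith) (by rwa [div_lt_iff₀ hm] at hn)
  have hex : ∀ γ : List (rose r).DirEdge, ∃ f : (rose r).DirEdge,
      γ ∈ T → (rose r).IsBasedCircuit ((k, true) :: γ ++ [f]) := by
    intro γ
    by_cases hγ : γ ∈ T
    · obtain ⟨f, hf⟩ := exists_isBasedCircuit_append hr _ γ (hT1 γ hγ).1
      exact ⟨f, fun _ => hf⟩
    · exact ⟨(k, true), fun h => absurd h hγ⟩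
  choose F hF using hex
  have hinj : Function.Injective
      fun γ : List (rose r).DirEdge => (((k, true) : (rose r).DirEdge) :: γ ++ [F γ]) := by
    intro a b hab
    exact (List.cons.inj (List.append_inj_left' hab rfl)).2
  have hle : T.card ≤ ((rose r).circuitsUpTo ℓ t).ncard := by
    rw [← Finset.card_image_of_injective T hinj, ← Set.ncard_coe_finset]
    refine Set.ncard_le_ncard ?_ (finite_rose_circuitsUpTo hm hml t)
    intro x hx
    simp only [Finset.coe_image, Set.mem_image, Finset.mem_coe] at hx
    obtain ⟨γ, hγ, rfl⟩ := hx
    refine ⟨hF γ hγ, ?_⟩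
    have h1 := (hT1 γ hγ).2
    have h2 := hM (F γ).1
    simp only [OrientedGraph.pathLength, List.map_append, List.sum_append, List.map_cons,
      List.map_nil, List.sum_cons, List.sum_nil] at h1 ⊢
    linarith
  calc _ = fermi (h * ℓ k) * Real.exp (h * (t - 2 * M)) := by
        rw [mul_assoc, ← Real.exp_add]; ring_nf
    _ ≤ T.card := hT2
    _ ≤ _ := by exact_mod_cast hle

lemma tendsto_log_mul_exp {c h : ℝ} (hc : 0 < c) :
    Tendsto (fun t : ℝ => (1 / t) * Real.log (c * Real.exp (h * t))) atTop (𝓝 h) := by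
  have h1 : Tendsto (fun t : ℝ => Real.log c * t⁻¹ + h) atTop (𝓝 (Real.log c * 0 + h)) :=
    (tendsto_inv_atTop_zero.const_mul _).add_const _
  rw [mul_zero, zero_add] at h1
  refine h1.congr' ?_
  filter_upwards [eventually_gt_atTop 0] with t ht
  rw [Real.log_mul hc.ne' (Real.exp_ne_zero _), Real.log_exp]
  field_simp

lemma tendsto_log_mul_mul_exp {c h : ℝ} (hc : 0 < c) :
    Tendsto (fun t : ℝ => (1 / t) * Real.log (c * t * Real.exp (h * t))) atTop (𝓝 h) := by
  have h0 : Tendsto (fun t : ℝ => Real.log t / t) atTop (𝓝 0) :=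
    Real.isLittleO_log_id_atTop.tendsto_div_nhds_zero
  have h1 := (tendsto_log_mul_exp (h := h) hc).add h0
  rw [add_zero] at h1
  refine h1.congr' ?_
  filter_upwards [eventually_gt_atTop 0] with t ht
  rw [mul_right_comm, Real.log_mul (x := c * _) (by positivity) ht.ne']
  field_simp

/-- The entropy of a length function on the rose, characterised by an implicit equation. -/
theorem rose_entropy_eq (hr : 2 ≤ r) {ℓ : Fin r → ℝ} {h : ℝ} (hl : ∀ k, 0 < ℓ k) (hh : 0 < h)
    (hs : roseSum (ℓ, h) = 1 / 2) : (rose r).entropy ℓ = h := by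
  have k : Fin r := ⟨0, by omega⟩
  have : Nonempty (Fin r) := ⟨k⟩
  obtain ⟨k₀, hk₀⟩ := Finite.exists_min ℓ
  obtain ⟨k₁, hk₁⟩ := Finite.exists_max ℓ
  have hm := hl k₀
  refine Tendsto.limUnder_eq ?_
  have hc : 0 < fermi (h * ℓ k) * Real.exp (-(h * (2 * ℓ k₁))) :=
    mul_pos (fermi_pos _) (Real.exp_pos _)
  have hC : 0 < 2 * (1 / ℓ k₀ + 1) := by positivity
  refine tendsto_of_tendsto_of_tendsto_of_le_of_le' (tendsto_log_mul_exp hc)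
    (tendsto_log_mul_mul_exp hC) ?_ ?_
  · filter_upwards [eventually_ge_atTop 1, eventually_ge_atTop (2 * ℓ k₁)] with t ht ht'
    exact mul_le_mul_of_nonneg_left (Real.log_le_log (by positivity)
      (le_ncard_rose_circuitsUpTo hr hh hm hk₀ hk₁ hs k ht')) (by positivity)
  · filter_upwards [eventually_ge_atTop 1, eventually_ge_atTop (2 * ℓ k₁)] with t ht ht'
    exact mul_le_mul_of_nonneg_left (Real.log_le_log ((by positivity : (0 : ℝ) < _).trans_le
      (le_ncard_rose_circuitsUpTo hr hh hm hk₀ hk₁ hs k ht'))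
      (ncard_rose_circuitsUpTo_le hh hm hk₀ hs ht)) (by positivity)

/-! ### Calculus of the logistic weight and its inverse -/

lemma fermi_lt_one (u : ℝ) : fermi u < 1 := by
  have := one_sub_fermi u
  have := mul_pos (Real.exp_pos u) (fermi_pos u)
  linarith

lemma fermi_lt_half {u : ℝ} (hu : 0 < u) : fermi u < 1 / 2 := by
  unfold fermi
  have := Real.one_lt_exp_iff.2 hu
  exact one_div_lt_one_div_of_lt (by norm_num) (by linarith)

lemma contDiff_fermi {n : WithTop ℕ∞} : ContDiff ℝ n fermi := by
  unfold fermi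
  exact contDiff_const.div (contDiff_const.add Real.contDiff_exp) fun u => by positivity

lemma hasDerivAt_fermi (u : ℝ) : HasDerivAt fermi (-(fermi u * (1 - fermi u))) u := by
  have h := (((Real.hasDerivAt_exp u).const_add 1).inv (by positivity))
  have h2 : fermi = (fun x => 1 + Real.exp x)⁻¹ := by
    ext x; simp [fermi]
  rw [h2]
  refine h.congr_deriv ?_
  change _ = -((1 + Real.exp u)⁻¹ * (1 - (1 + Real.exp u)⁻¹))
  field_simp
  ring

lemma tendsto_fermi_atTop : Tendsto fermi atTop (𝓝 0) := by
  unfold fermi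
  simp_rw [one_div]
  exact tendsto_inv_atTop_zero.comp (tendsto_atTop_add_const_left _ _ Real.tendsto_exp_atTop)

/-- The inverse of the logistic weight. -/
noncomputable def logit (a : ℝ) : ℝ := Real.log (1 - a) - Real.log a

lemma logit_fermi (u : ℝ) : logit (fermi u) = u := by
  unfold logit
  rw [one_sub_fermi, Real.log_mul (Real.exp_ne_zero _) (fermi_pos u).ne', Real.log_exp]
  ring

lemma fermi_logit {a : ℝ} (h0 : 0 < a) (h1 : a < 1) : fermi (logit a) = a := by
  unfold fermi logit
  rw [Real.exp_sub, Real.exp_log h0, Real.exp_log (by linarith)]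
  field_simp
  ring

lemma logit_anti {a b : ℝ} (h0 : 0 < a) (hab : a ≤ b) (h1 : b < 1) : logit b ≤ logit a := by
  unfold logit
  have h2 := Real.log_le_log h0 hab
  have h3 := Real.log_le_log (by linarith : 0 < 1 - b) (by linarith : 1 - b ≤ 1 - a)
  linarith

lemma logit_pos {a : ℝ} (h0 : 0 < a) (h1 : a < 1 / 2) : 0 < logit a := by
  unfold logit
  have := Real.log_lt_log h0 (by linarith : a < 1 - a)
  linarith

lemma contDiffAt_logit {a : ℝ} (h0 : 0 < a) (h1 : a < 1) {n : WithTop ℕ∞} :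
    ContDiffAt ℝ n logit a := by
  unfold logit
  exact ((contDiffAt_const.sub contDiffAt_id).log (by simpa using (by linarith : 1 - a ≠ 0))).sub
    (contDiffAt_id.log h0.ne')

lemma hasDerivAt_logit {a : ℝ} (h0 : 0 < a) (h1 : a < 1) :
    HasDerivAt logit (-(a * (1 - a))⁻¹) a := by
  have h2 : 1 - a ≠ 0 := by linarith
  have := (((hasDerivAt_id a).const_sub 1).log h2).sub (Real.hasDerivAt_log h0.ne')
  refine this.congr_deriv ?_
  change -1 / (1 - a) - a⁻¹ = _
  field_simp
  ring

lemma tendsto_logit_zero : Tendsto logit (𝓝[>] 0) atTop := by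
  have h1 : Tendsto (fun a : ℝ => Real.log (1 - a)) (𝓝[>] 0) (𝓝 (Real.log (1 - 0))) := by
    refine (ContinuousAt.tendsto ?_).mono_left nhdsWithin_le_nhds
    exact (continuousAt_const.sub continuousAt_id).log (by simp)
  have h2 := tendsto_neg_atBot_atTop.comp Real.tendsto_log_nhdsGT_zero
  exact h1.add_atTop h2

lemma contDiff_roseSum {n : WithTop ℕ∞} : ContDiff ℝ n (roseSum (r := r)) := by
  unfold roseSum
  refine ContDiff.sum fun k _ => contDiff_fermi.comp (contDiff_snd.mul ?_)
  exact (contDiff_apply ℝ ℝ k).comp contDiff_fst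

/-! ### The unit entropy space and the derivatives of the entropy -/

/-- Intermediate values: the sum is `r / 2 ≥ 1` at `h = 0` and tends to 0 at infinity. -/
lemma exists_roseSum_eq (hr : 2 ≤ r) {ℓ : Fin r → ℝ} (hl : ∀ k, 0 < ℓ k) :
    ∃ h, 0 < h ∧ roseSum (ℓ, h) = 1 / 2 := by
  have hcont : Continuous fun h : ℝ => roseSum (ℓ, h) :=
    (contDiff_roseSum (n := 0)).continuous.comp (by fun_prop)
  have h0 : roseSum (ℓ, 0) = r / 2 := by
    simp [roseSum, fermi]
    ring
  have hlim : Tendsto (fun h : ℝ => roseSum (ℓ, h)) atTop (𝓝 (∑ _k : Fin r, (0 : ℝ))) :=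
    tendsto_finsetSum _ fun k _ => tendsto_fermi_atTop.comp (tendsto_id.atTop_mul_const (hl k))
  rw [Finset.sum_const_zero] at hlim
  obtain ⟨H, hH0, hH⟩ := ((eventually_gt_atTop 0).and
    (hlim.eventually (gt_mem_nhds (by norm_num : (0 : ℝ) < 1 / 2)))).exists
  have hr' : (2 : ℝ) ≤ r := by exact_mod_cast hr
  obtain ⟨h, hh, hh'⟩ := intermediate_value_Icc' hH0.le hcont.continuousOn
    (show (1 / 2 : ℝ) ∈ Icc (roseSum (ℓ, H)) (roseSum (ℓ, 0)) from
      ⟨hH.le, by rw [h0]; linarith⟩)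
  refine ⟨h, lt_of_le_of_ne hh.1 ?_, hh'⟩
  rintro rfl
  simp only [h0] at hh'
  linarith

lemma roseSum_entropy (hr : 2 ≤ r) {ℓ : Fin r → ℝ} (hl : ∀ k, 0 < ℓ k) :
    roseSum (ℓ, (rose r).entropy ℓ) = 1 / 2 := by
  obtain ⟨h, hh, hs⟩ := exists_roseSum_eq hr hl
  rw [rose_entropy_eq hr hl hh hs, hs]

/-- Unit entropy length functions on the rose are cut out by one explicit equation. -/
lemma mem_rose_unitEntropy (hr : 2 ≤ r) {ℓ : Fin r → ℝ} :
    ℓ ∈ (rose r).unitEntropy ↔ (∀ k, 0 < ℓ k) ∧ ∑ k, fermi (ℓ k) = 1 / 2 := by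
  constructor
  · rintro ⟨hl, h1⟩
    refine ⟨hl, ?_⟩
    have := roseSum_entropy hr hl
    rw [h1] at this
    simpa [roseSum] using this
  · rintro ⟨hl, h1⟩
    exact ⟨hl, rose_entropy_eq hr hl one_pos (by simpa [roseSum] using h1)⟩

/-- The common denominator in the formulas for the derivatives of the entropy. -/
noncomputable def roseDenom (ℓ : Fin r → ℝ) : ℝ := ∑ k, ℓ k * (fermi (ℓ k) * (1 - fermi (ℓ k)))

lemma roseDenom_pos (hr : 2 ≤ r) {ℓ : Fin r → ℝ} (hl : ∀ k, 0 < ℓ k) : 0 < roseDenom ℓ := by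
  have : Nonempty (Fin r) := ⟨⟨0, by omega⟩⟩
  refine Finset.sum_pos (fun k _ => ?_) Finset.univ_nonempty
  have h1 := hl k
  have h2 := fermi_pos (ℓ k)
  have h3 := fermi_lt_one (ℓ k)
  exact mul_pos h1 (mul_pos h2 (by linarith))

/-- Implicit function theorem for `roseSum` at `(ℓ, 1)`, where the derivative in `h` is `-roseDenom
ℓ ≠ 0`. Nearby, the implicit solution is positive, so `rose_entropy_eq` identifies it with the
entropy. -/
lemma contDiffAt_rose_entropy (hr : 2 ≤ r) {ℓ : Fin r → ℝ} (hℓ : ℓ ∈ (rose r).unitEntropy) :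
    ContDiffAt ℝ ∞ (rose r).entropy ℓ := by
  obtain ⟨hl, h1⟩ := (mem_rose_unitEntropy hr).1 hℓ
  have hcd : ContDiffAt ℝ ∞ (roseSum (r := r)) (ℓ, 1) := contDiff_roseSum.contDiffAt
  have hline : HasDerivAt (fun h : ℝ => roseSum (ℓ, h)) (-roseDenom ℓ) 1 := by
    unfold roseSum roseDenom
    rw [← Finset.sum_neg_distrib]
    refine HasDerivAt.fun_sum fun k _ => ?_
    have h2 := (hasDerivAt_fermi (1 * ℓ k)).comp (1 : ℝ) ((hasDerivAt_id (1 : ℝ)).mul_const (ℓ k))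
    refine h2.congr_deriv ?_
    rw [one_mul]
    ring
  have hd : (fderiv ℝ (roseSum (r := r)) (ℓ, 1) ∘L .inr ℝ (Fin r → ℝ) ℝ) 1 = -roseDenom ℓ := by
    have h2 := (hcd.differentiableAt (by simp)).hasFDerivAt.comp_hasDerivAt (1 : ℝ)
      ((hasDerivAt_const (1 : ℝ) ℓ).prodMk (hasDerivAt_id (1 : ℝ)))
    exact h2.unique hline
  have hinv : (fderiv ℝ (roseSum (r := r)) (ℓ, 1) ∘L .inr ℝ (Fin r → ℝ) ℝ).IsInvertible := by
    have hne : -roseDenom ℓ ≠ 0 := (neg_neg_of_pos (roseDenom_pos hr hl)).ne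
    refine ⟨ContinuousLinearEquiv.unitsEquivAut ℝ (Units.mk0 _ hne), ?_⟩
    ext
    simpa using hd.symm
  set ψ := hcd.implicitFunction (by simp) hinv with hψ
  have hψc : ContDiffAt ℝ ∞ ψ ℓ := hcd.contDiffAt_implicitFunction (by simp) hinv
  have hψ1 : ψ ℓ = 1 := hcd.implicitFunction_apply_self (by simp) hinv
  have hψe : ∀ᶠ x in 𝓝 ℓ, roseSum (x, ψ x) = roseSum (ℓ, 1) :=
    hcd.eventually_apply_implicitFunction (by simp) hinv
  have hψp : ∀ᶠ x in 𝓝 ℓ, 0 < ψ x := by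
    refine hψc.continuousAt.eventually (lt_mem_nhds ?_)
    rw [hψ1]; exact one_pos
  have hpos : ∀ᶠ x : Fin r → ℝ in 𝓝 ℓ, ∀ k, 0 < x k :=
    eventually_all.2 fun k => (continuous_apply k).continuousAt.eventually (lt_mem_nhds (hl k))
  refine hψc.congr_of_eventuallyEq ?_
  filter_upwards [hψe, hψp, hpos] with x h2 h3 h4
  refine rose_entropy_eq hr h4 h3 (h2.trans ?_)
  simpa [roseSum] using h1

/-- Differentiate the implicit equation along the line `ℓ + s • w` and solve for the derivative of
the entropy. -/
lemma fderiv_rose_entropy (hr : 2 ≤ r) {ℓ : Fin r → ℝ} (hℓ : ℓ ∈ (rose r).unitEntropy)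
    (w : Fin r → ℝ) :
    fderiv ℝ (rose r).entropy ℓ w
      = -(∑ k, w k * (fermi (ℓ k) * (1 - fermi (ℓ k)))) / roseDenom ℓ := by
  have hl := ((mem_rose_unitEntropy hr).1 hℓ).1
  have hline : HasDerivAt (fun s : ℝ => ℓ + s • w) w 0 := by
    simpa using ((hasDerivAt_id (0 : ℝ)).smul_const w).const_add ℓ
  have hent : HasDerivAt (fun s : ℝ => (rose r).entropy (ℓ + s • w))
      (fderiv ℝ (rose r).entropy ℓ w) 0 := by
    have h1 := ((contDiffAt_rose_entropy hr hℓ).differentiableAt (by simp)).hasFDerivAt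
    exact HasFDerivAt.comp_hasDerivAt_of_eq 0 h1 hline (by simp)
  set d := fderiv ℝ (rose r).entropy ℓ w with hd
  have hsum : HasDerivAt (fun s : ℝ => roseSum (ℓ + s • w, (rose r).entropy (ℓ + s • w)))
      (∑ k, -(fermi (ℓ k) * (1 - fermi (ℓ k))) * (d * ℓ k + w k)) 0 := by
    unfold roseSum
    refine HasDerivAt.fun_sum fun k _ => ?_
    have h2 := hent.mul (hasDerivAt_pi.1 hline k)
    have h3 : (rose r).entropy ℓ = 1 := hℓ.2
    have h4 := (hasDerivAt_fermi _).comp (0 : ℝ) h2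
    simpa [h3, Function.comp_def] using h4
  have hev : ∀ᶠ s : ℝ in 𝓝 0, roseSum (ℓ + s • w, (rose r).entropy (ℓ + s • w)) = 1 / 2 := by
    have : ∀ᶠ s : ℝ in 𝓝 0, ∀ k, 0 < (ℓ + s • w) k := by
      refine eventually_all.2 fun k => ?_
      have hc : ContinuousAt (fun s : ℝ => (ℓ + s • w) k) 0 := by fun_prop
      exact hc.eventually (lt_mem_nhds (by simpa using hl k))
    filter_upwards [this] with s hs using roseSum_entropy hr hs
  have h0 := hsum.unique ((hasDerivAt_const (0 : ℝ) (1 / 2 : ℝ)).congr_of_eventuallyEq hev)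
  have hD := roseDenom_pos hr hl
  rw [eq_div_iff hD.ne']
  unfold roseDenom
  rw [Finset.mul_sum, ← Finset.sum_neg_distrib, ← sub_eq_zero, ← Finset.sum_sub_distrib,
    ← neg_eq_zero, ← Finset.sum_neg_distrib, ← h0]
  exact Finset.sum_congr rfl fun k _ => by ring

/-- The second derivative of a function on the velocity of a curve in one of its level sets. -/
lemma fderiv_fderiv_apply_of_const {E : Type*} [NormedAddCommGroup E] [NormedSpace ℝ E]
    {f : E → ℝ} {c c' : ℝ → E} {c'' : E} {t a : ℝ} (hf : ContDiffAt ℝ ∞ f (c t))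
    (hc : ∀ᶠ s in 𝓝 t, HasDerivAt c (c' s) s) (hc' : HasDerivAt c' c'' t)
    (hconst : ∀ᶠ s in 𝓝 t, f (c s) = a) :
    fderiv ℝ (fderiv ℝ f) (c t) (c' t) (c' t) = -fderiv ℝ f (c t) c'' := by
  have hct := hc.self_of_nhds
  have hf1 : ∀ᶠ x in 𝓝 (c t), DifferentiableAt ℝ f x :=
    ((hf.of_le (m := 1) (by exact_mod_cast le_top)).eventually (by simp)).mono
      fun x hx => hx.differentiableAt (by simp)
  have hf2 : DifferentiableAt ℝ (fderiv ℝ f) (c t) :=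
    (hf.fderiv_right (m := 1) (WithTop.coe_le_coe.2 le_top)).differentiableAt (by simp)
  -- The velocity is tangent to the level set at all nearby times; differentiating this identity
  -- once more gives the claim.
  have hvel : ∀ᶠ s in 𝓝 t, fderiv ℝ f (c s) (c' s) = 0 := by
    filter_upwards [hc, hct.continuousAt.eventually hf1, hconst.eventually_nhds] with s h1 h2 h3
    exact (h2.hasFDerivAt.comp_hasDerivAt s h1).unique
      ((hasDerivAt_const s a).congr_of_eventuallyEq h3)
  have h1 : HasDerivAt (fun s => fderiv ℝ f (c s)) (fderiv ℝ (fderiv ℝ f) (c t) (c' t)) t :=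
    hf2.hasFDerivAt.comp_hasDerivAt t hct
  have h2 := (h1.clm_apply hc').unique ((hasDerivAt_const t (0 : ℝ)).congr_of_eventuallyEq hvel)
  linarith

/-! ### Paths that are straight in the weights -/

/-- The line segment joining the logistic weights of two length functions. -/
noncomputable def weightSegment (x y : Fin r → ℝ) (t : ℝ) (k : Fin r) : ℝ :=
  fermi (x k) + t * (fermi (y k) - fermi (x k))

/-- The path of length functions along which the logistic weights move on a line segment. -/
noncomputable def logitPath (x y : Fin r → ℝ) (t : ℝ) (k : Fin r) : ℝ :=
  logit (weightSegment x y t k)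

lemma hasDerivAt_weightSegment (x y : Fin r → ℝ) (t : ℝ) (k : Fin r) :
    HasDerivAt (fun s => weightSegment x y s k) (fermi (y k) - fermi (x k)) t := by
  unfold weightSegment
  simpa using ((hasDerivAt_id t).mul_const (fermi (y k) - fermi (x k))).const_add (fermi (x k))

/-- Openness makes the path formulas valid on a two-sided neighbourhood of each time, including 0
and 1. -/
lemma isOpen_weightSegment (x y : Fin r → ℝ) :
    IsOpen {t | ∀ k, 0 < weightSegment x y t k ∧ weightSegment x y t k < 1 / 2} := by
  have hc : ∀ k, Continuous fun t => weightSegment x y t k := fun k => by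
    unfold weightSegment; fun_prop
  simp only [Set.ofPred_forall]
  exact isOpen_iInter_of_finite fun k =>
    (isOpen_lt continuous_const (hc k)).inter (isOpen_lt (hc k) continuous_const)

lemma weightSegment_mem {x y : Fin r → ℝ} (hx : ∀ k, 0 < x k) (hy : ∀ k, 0 < y k) {t : ℝ}
    (ht : t ∈ Icc (0 : ℝ) 1) (k : Fin r) :
    0 < weightSegment x y t k ∧ weightSegment x y t k < 1 / 2 := by
  have h : weightSegment x y t k ∈ Ioo (0 : ℝ) (1 / 2) := by
    refine (convex_Ioo (0 : ℝ) (1 / 2)).add_smul_sub_mem ⟨fermi_pos _, fermi_lt_half (hx k)⟩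
      ⟨fermi_pos _, fermi_lt_half (hy k)⟩ ht
  exact h

lemma logitPath_mem (hr : 2 ≤ r) {x y : Fin r → ℝ} (hx : x ∈ (rose r).unitEntropy)
    (hy : y ∈ (rose r).unitEntropy) {t : ℝ}
    (ht : ∀ k, 0 < weightSegment x y t k ∧ weightSegment x y t k < 1 / 2) :
    logitPath x y t ∈ (rose r).unitEntropy := by
  rw [mem_rose_unitEntropy hr]
  refine ⟨fun k => logit_pos (ht k).1 (ht k).2, ?_⟩
  have h1 : ∀ k, fermi (logitPath x y t k) = weightSegment x y t k := fun k =>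
    fermi_logit (ht k).1 (by linarith [(ht k).2])
  have hx' := ((mem_rose_unitEntropy hr).1 hx).2
  have hy' := ((mem_rose_unitEntropy hr).1 hy).2
  simp only [h1, weightSegment]
  rw [Finset.sum_add_distrib, ← Finset.mul_sum, Finset.sum_sub_distrib, hx', hy']
  ring

lemma hasDerivAt_logitPath {x y : Fin r → ℝ} {t : ℝ}
    (ht : ∀ k, 0 < weightSegment x y t k ∧ weightSegment x y t k < 1 / 2) :
    HasDerivAt (logitPath x y) (fun k => -(weightSegment x y t k * (1 - weightSegment x y t k))⁻¹ *
      (fermi (y k) - fermi (x k))) t :=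
  hasDerivAt_pi.2 fun k => (hasDerivAt_logit (ht k).1 (by linarith [(ht k).2])).comp t
    (hasDerivAt_weightSegment x y t k)

lemma isPath_logitPath (hr : 2 ≤ r) {x y : Fin r → ℝ} (hx : x ∈ (rose r).unitEntropy)
    (hy : y ∈ (rose r).unitEntropy) : (rose r).IsPath (logitPath x y) := by
  have hmem : ∀ t ∈ Icc (0 : ℝ) 1, ∀ k, 0 < weightSegment x y t k ∧ weightSegment x y t k < 1 / 2 :=
    fun t ht => weightSegment_mem hx.1 hy.1 ht
  have hsm : ContDiffOn ℝ ∞ (logitPath x y) (Icc 0 1) := by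
    intro t ht
    refine (contDiffAt_pi.2 fun k => ?_).contDiffWithinAt
    refine ContDiffAt.comp t (contDiffAt_logit (hmem t ht k).1
      (by linarith [(hmem t ht k).2])) ?_
    exact contDiffAt_const.add (contDiffAt_id.mul contDiffAt_const)
  refine ⟨hsm.continuousOn, fun t ht => logitPath_mem hr hx hy (hmem t ht), 1, fun n => n,
    by simp, by simp, ?_⟩
  intro k hk
  obtain rfl : k = 0 := by omega
  simpa using hsm

/-- The acceleration has denominator `(a * (1 - a)) ^ 2`; the differential of the entropy
contributes `a * (1 - a)` and cancels one power. -/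
lemma entropyInner_logitPath (hr : 2 ≤ r) {x y : Fin r → ℝ} (hx : x ∈ (rose r).unitEntropy)
    (hy : y ∈ (rose r).unitEntropy) {t : ℝ}
    (ht : ∀ k, 0 < weightSegment x y t k ∧ weightSegment x y t k < 1 / 2) :
    (rose r).entropyInner (logitPath x y t) (deriv (logitPath x y) t) (deriv (logitPath x y) t)
      = (∑ k, (fermi (y k) - fermi (x k)) ^ 2 * (1 - 2 * weightSegment x y t k) /
          (weightSegment x y t k * (1 - weightSegment x y t k))) / roseDenom (logitPath x y t) := by
  have hU : ∀ᶠ s in 𝓝 t, ∀ k, 0 < weightSegment x y s k ∧ weightSegment x y s k < 1 / 2 :=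
    (isOpen_weightSegment x y).mem_nhds ht
  have hmem := logitPath_mem hr hx hy ht
  have hc : ∀ᶠ s in 𝓝 t, HasDerivAt (logitPath x y) _ s :=
    hU.mono fun s hs => hasDerivAt_logitPath hs
  have hc' : HasDerivAt (fun s k => -(weightSegment x y s k * (1 - weightSegment x y s k))⁻¹ *
      (fermi (y k) - fermi (x k))) (fun k => (fermi (y k) - fermi (x k)) ^ 2 *
        (1 - 2 * weightSegment x y t k) /
          (weightSegment x y t k * (1 - weightSegment x y t k)) ^ 2) t := by
    refine hasDerivAt_pi.2 fun k => ?_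
    have h1 := hasDerivAt_weightSegment x y t k
    have hne : weightSegment x y t k * (1 - weightSegment x y t k) ≠ 0 :=
      (mul_pos (ht k).1 (by linarith [(ht k).2])).ne'
    refine (((h1.mul (h1.const_sub 1)).inv hne).neg.mul_const _).congr_deriv ?_
    change -(-_ / (weightSegment x y t k * (1 - weightSegment x y t k)) ^ 2) * _ = _
    ring
  have hconst : ∀ᶠ s in 𝓝 t, (rose r).entropy (logitPath x y s) = 1 :=
    hU.mono fun s hs => (logitPath_mem hr hx hy hs).2
  rw [OrientedGraph.entropyInner, (hasDerivAt_logitPath ht).deriv,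
    fderiv_fderiv_apply_of_const (contDiffAt_rose_entropy hr hmem) hc hc' hconst,
    fderiv_rose_entropy hr hmem, neg_div, neg_neg]
  congr 1
  refine Finset.sum_congr rfl fun k _ => ?_
  have h1 : fermi (logitPath x y t k) = weightSegment x y t k :=
    fermi_logit (ht k).1 (by linarith [(ht k).2])
  have h2 := (ht k).1.ne'
  have h3 : 1 - weightSegment x y t k ≠ 0 := by linarith [(ht k).2]
  rw [h1]
  field_simp

/-! ### Length estimate on a slice and the limit -/

/-- A bound on the square root of a sum of squares by the sum of the absolute values. -/
lemma sqrt_sum_le_sum_sqrt {ι : Type*} (s : Finset ι) (f : ι → ℝ) (hf : ∀ k ∈ s, 0 ≤ f k) :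
    √(∑ k ∈ s, f k) ≤ ∑ k ∈ s, √(f k) := by
  refine Real.sqrt_le_iff.2 ⟨Finset.sum_nonneg fun _ _ => Real.sqrt_nonneg _, ?_⟩
  calc ∑ k ∈ s, f k = ∑ k ∈ s, √(f k) ^ 2 :=
        Finset.sum_congr rfl fun k hk => (Real.sq_sqrt (hf k hk)).symm
    _ ≤ _ := Finset.sum_sq_le_sq_sum_of_nonneg fun k _ => Real.sqrt_nonneg _

/-- Drop the `i`-th term. The other weights sum to `1 / 2 - fermi ε`, so each is at most this and
its `logit` is at least that of the total; also `1 - a ≥ 1 / 2`. -/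
lemma le_roseDenom_logitPath (hr : 2 ≤ r) {i : Fin r} {ε : ℝ} {x y : Fin r → ℝ}
    (hx : x ∈ roseSlice r i ε) (hy : y ∈ roseSlice r i ε) {t : ℝ} (ht : t ∈ Icc (0 : ℝ) 1) :
    logit (1 / 2 - fermi ε) / 2 * (1 / 2 - fermi ε) ≤ roseDenom (logitPath x y t) := by
  have hm := weightSegment_mem hx.1.1 hy.1.1 ht
  have hmem := logitPath_mem hr hx.1 hy.1 hm
  have h1 : ∀ k, fermi (logitPath x y t k) = weightSegment x y t k := fun k =>
    fermi_logit (hm k).1 (by linarith [(hm k).2])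
  have hsum := ((mem_rose_unitEntropy hr).1 hmem).2
  have hpos := ((mem_rose_unitEntropy hr).1 hmem).1
  simp only [h1] at hsum
  have hi : weightSegment x y t i = fermi ε := by
    unfold weightSegment
    rw [hx.2, hy.2]; ring
  rw [← Finset.sum_erase_add _ _ (Finset.mem_univ i), hi] at hsum
  have hsum' : ∑ k ∈ Finset.univ.erase i, weightSegment x y t k = 1 / 2 - fermi ε := by linarith
  have hε : 0 < ε := hx.2 ▸ hx.1.1 i
  unfold roseDenom
  rw [← Finset.sum_erase_add _ _ (Finset.mem_univ i)]
  have hi0 : 0 ≤ logitPath x y t i * (fermi (logitPath x y t i) *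
      (1 - fermi (logitPath x y t i))) := by
    have h2 := (hpos i).le
    have h3 := (fermi_pos (logitPath x y t i)).le
    have h4 := fermi_lt_one (logitPath x y t i)
    exact mul_nonneg h2 (mul_nonneg h3 (by linarith))
  refine le_add_of_le_of_nonneg ?_ hi0
  nth_rewrite 2 [← hsum']
  rw [Finset.mul_sum]
  refine Finset.sum_le_sum fun k hk => ?_
  rw [h1]
  have hle : weightSegment x y t k ≤ 1 / 2 - fermi ε := by
    rw [← hsum']
    exact Finset.single_le_sum (f := fun k => weightSegment x y t k) (fun j _ => (hm j).1.le) hk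
  have hL : logit (1 / 2 - fermi ε) ≤ logitPath x y t k :=
    logit_anti (hm k).1 hle (by linarith [fermi_pos ε])
  have hL0 : 0 < logit (1 / 2 - fermi ε) :=
    logit_pos (by linarith [fermi_lt_half hε]) (by linarith [fermi_pos ε])
  obtain ⟨h2, h3⟩ := hm k
  calc logit (1 / 2 - fermi ε) / 2 * weightSegment x y t k
      = logit (1 / 2 - fermi ε) * (weightSegment x y t k * (1 / 2)) := by ring
    _ ≤ _ := mul_le_mul hL (mul_le_mul_of_nonneg_left (by linarith) h2.le)
        (by positivity) (hpos k).le

lemma entropyNorm_logitPath_le (hr : 2 ≤ r) {i : Fin r} {ε : ℝ} {x y : Fin r → ℝ}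
    (hx : x ∈ roseSlice r i ε) (hy : y ∈ roseSlice r i ε) {t : ℝ} (ht : t ∈ Icc (0 : ℝ) 1) :
    (rose r).entropyNorm (logitPath x y t) (deriv (logitPath x y) t)
      ≤ (∑ k, |fermi (y k) - fermi (x k)| / √(weightSegment x y t k)) /
        √(logit (1 / 2 - fermi ε) / 2 * (1 / 2 - fermi ε)) := by
  have hm := weightSegment_mem hx.1.1 hy.1.1 ht
  have hε : 0 < ε := hx.2 ▸ hx.1.1 i
  have hδ : 0 < 1 / 2 - fermi ε := by linarith [fermi_lt_half hε]
  have hL0 : 0 < logit (1 / 2 - fermi ε) := logit_pos hδ (by linarith [fermi_pos ε])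
  rw [OrientedGraph.entropyNorm, entropyInner_logitPath hr hx.1 hy.1 hm]
  have hterm : ∀ k, (fermi (y k) - fermi (x k)) ^ 2 * (1 - 2 * weightSegment x y t k) /
      (weightSegment x y t k * (1 - weightSegment x y t k))
      ≤ (fermi (y k) - fermi (x k)) ^ 2 / weightSegment x y t k := by
    intro k
    obtain ⟨h1, h2⟩ := hm k
    have h3 : 0 < 1 - weightSegment x y t k := by linarith
    rw [mul_div_mul_comm]
    refine mul_le_of_le_one_right (by positivity) ?_
    rw [div_le_one h3]
    linarith
  have hnn : ∀ k, 0 ≤ (fermi (y k) - fermi (x k)) ^ 2 / weightSegment x y t k := fun k => by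
    have := (hm k).1
    positivity
  calc _ ≤ √((∑ k, (fermi (y k) - fermi (x k)) ^ 2 / weightSegment x y t k) /
          (logit (1 / 2 - fermi ε) / 2 * (1 / 2 - fermi ε))) := by
        refine Real.sqrt_le_sqrt (div_le_div₀ (Finset.sum_nonneg fun k _ => hnn k)
          (Finset.sum_le_sum fun k _ => hterm k) (by positivity)
          (le_roseDenom_logitPath hr hx hy ht))
    _ = √(∑ k, (fermi (y k) - fermi (x k)) ^ 2 / weightSegment x y t k) /
          √(logit (1 / 2 - fermi ε) / 2 * (1 / 2 - fermi ε)) :=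
        Real.sqrt_div (Finset.sum_nonneg fun k _ => hnn k) _
    _ ≤ _ := by
        gcongr
        refine (sqrt_sum_le_sum_sqrt _ _ fun k _ => hnn k).trans_eq ?_
        refine Finset.sum_congr rfl fun k _ => ?_
        rw [Real.sqrt_div (sq_nonneg _), Real.sqrt_sq_eq_abs]

lemma entropyLength_logitPath_le (hr : 2 ≤ r) {i : Fin r} {ε : ℝ} {x y : Fin r → ℝ}
    (hx : x ∈ roseSlice r i ε) (hy : y ∈ roseSlice r i ε) :
    (rose r).entropyLength (logitPath x y)
      ≤ ENNReal.ofReal (2 * r / √(logit (1 / 2 - fermi ε) / 2)) := by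
  have hm : ∀ t ∈ Icc (0 : ℝ) 1, ∀ k, 0 < weightSegment x y t k := fun t ht k =>
    (weightSegment_mem hx.1.1 hy.1.1 ht k).1
  have hε : 0 < ε := hx.2 ▸ hx.1.1 i
  have hδ : 0 < 1 / 2 - fermi ε := by linarith [fermi_lt_half hε]
  have hL0 : 0 < logit (1 / 2 - fermi ε) := logit_pos hδ (by linarith [fermi_pos ε])
  set K := √(logit (1 / 2 - fermi ε) / 2 * (1 / 2 - fermi ε)) with hK
  have hK' : K = √(logit (1 / 2 - fermi ε) / 2) * √(1 / 2 - fermi ε) :=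
    Real.sqrt_mul (by positivity) _
  set G : ℝ → ℝ := fun t =>
    (∑ k, |fermi (y k) - fermi (x k)| / √(weightSegment x y t k)) / K with hG
  -- An explicit antiderivative of `G`: each weight moves with constant velocity, so the sign in `|Δ
  -- k|` does not depend on `t`.
  set Φ : ℝ → ℝ := fun t => (∑ k, SignType.sign (fermi (y k) - fermi (x k)) *
    (2 * √(weightSegment x y t k))) / K with hΦ
  have hderiv : ∀ t ∈ Icc (0 : ℝ) 1, HasDerivAt Φ (G t) t := by
    intro t ht
    refine HasDerivAt.div_const (HasDerivAt.fun_sum fun k _ => ?_) K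
    refine ((((hasDerivAt_weightSegment x y t k).sqrt (hm t ht k).ne').const_mul 2).const_mul
      ((SignType.sign (fermi (y k) - fermi (x k)) : SignType) : ℝ)).congr_deriv ?_
    rw [← sign_mul_self (fermi (y k) - fermi (x k))]
    have := (Real.sqrt_pos.2 (hm t ht k)).ne'
    field_simp
  have hcont : ContinuousOn G (Icc 0 1) := by
    refine ContinuousOn.div_const (continuousOn_finsetSum _ fun k _ => ?_) K
    refine continuousOn_const.div ?_ fun t ht => (Real.sqrt_pos.2 (hm t ht k)).ne'
    exact (Real.continuous_sqrt.comp (continuous_iff_continuousAt.2 fun t =>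
      (hasDerivAt_weightSegment x y t k).continuousAt)).continuousOn
  have hint : IntegrableOn G (Icc 0 1) := hcont.integrableOn_Icc
  have hG0 : ∀ t, 0 ≤ G t := fun t => by
    simp only [hG]
    positivity
  have hFTC : ∫ t in Icc (0 : ℝ) 1, G t = Φ 1 - Φ 0 := by
    rw [integral_Icc_eq_integral_Ioc, ← intervalIntegral.integral_of_le zero_le_one]
    refine intervalIntegral.integral_eq_sub_of_hasDerivAt ?_ ?_
    · rwa [uIcc_of_le zero_le_one]
    · exact (hcont.mono (by rw [uIcc_of_le zero_le_one])).intervalIntegrable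
  have hbd : ∀ z ∈ roseSlice r i ε, ∀ k, k ≠ i → fermi (z k) ≤ 1 / 2 - fermi ε := by
    intro z hz k hk
    have hsum := ((mem_rose_unitEntropy hr).1 hz.1).2
    rw [← Finset.sum_erase_add _ _ (Finset.mem_univ i), hz.2] at hsum
    have := Finset.single_le_sum (f := fun k => fermi (z k)) (fun j _ => (fermi_pos _).le)
      (Finset.mem_erase.2 ⟨hk, Finset.mem_univ k⟩)
    linarith
  have hend : Φ 1 - Φ 0 ≤ 2 * r / √(logit (1 / 2 - fermi ε) / 2) := by
    have hk : ∀ k, SignType.sign (fermi (y k) - fermi (x k)) * (2 * √(weightSegment x y 1 k)) -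
        SignType.sign (fermi (y k) - fermi (x k)) * (2 * √(weightSegment x y 0 k))
        ≤ 2 * √(1 / 2 - fermi ε) := by
      intro k
      have h1 : weightSegment x y 1 k = fermi (y k) := by unfold weightSegment; ring
      have h0 : weightSegment x y 0 k = fermi (x k) := by unfold weightSegment; ring
      rw [h1, h0]
      by_cases hki : k = i
      · rw [hki, hx.2, hy.2]
        simp
      · have h2 := Real.sqrt_le_sqrt (hbd x hx k hki)
        have h3 := Real.sqrt_le_sqrt (hbd y hy k hki)
        have h4 := Real.sqrt_nonneg (fermi (x k))
        have h5 := Real.sqrt_nonneg (fermi (y k))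
        rcases lt_trichotomy (fermi (y k) - fermi (x k)) 0 with h | h | h
        · rw [sign_neg h, SignType.coe_neg, SignType.coe_one]; linarith
        · rw [h]; simp
        · rw [sign_pos h, SignType.coe_one]; linarith
    have hsum := Finset.sum_le_sum fun k (_ : k ∈ Finset.univ) => hk k
    rw [Finset.sum_sub_distrib] at hsum
    simp only [Finset.sum_const, Finset.card_univ, Fintype.card_fin, nsmul_eq_mul] at hsum
    simp only [hΦ]
    rw [← sub_div, hK']
    have hs1 : 0 < √(logit (1 / 2 - fermi ε) / 2) := Real.sqrt_pos.2 (by positivity)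
    have hs2 : 0 < √(1 / 2 - fermi ε) := Real.sqrt_pos.2 hδ
    -- The factor `√(1 / 2 - fermi ε)` from the end points cancels against the one in `K`.
    rw [div_le_div_iff₀ (by positivity) hs1]
    nlinarith [mul_le_mul_of_nonneg_right hsum hs1.le]
  calc (rose r).entropyLength (logitPath x y)
      ≤ ∫⁻ t in Icc (0 : ℝ) 1, ENNReal.ofReal (G t) :=
        setLIntegral_mono' measurableSet_Icc fun t ht =>
          ENNReal.ofReal_le_ofReal (entropyNorm_logitPath_le hr hx hy ht)
    _ = ENNReal.ofReal (∫ t in Icc (0 : ℝ) 1, G t) :=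
        (ofReal_integral_eq_lintegral_ofReal hint (ae_of_all _ hG0)).symm
    _ ≤ _ := ENNReal.ofReal_le_ofReal (hFTC ▸ hend)

lemma entropyDiam_roseSlice_le (hr : 2 ≤ r) (i : Fin r) (ε : ℝ) :
    (rose r).entropyDiam (roseSlice r i ε)
      ≤ ENNReal.ofReal (2 * r / √(logit (1 / 2 - fermi ε) / 2)) := by
  refine iSup₂_le fun x hx => iSup₂_le fun y hy => ?_
  have h0 : logitPath x y 0 = x := by
    ext k; simp [logitPath, weightSegment, logit_fermi]
  have h1 : logitPath x y 1 = y := by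
    ext k; simp [logitPath, weightSegment, logit_fermi]
  exact (iInf₂_le (logitPath x y) ⟨isPath_logitPath hr hx.1 hy.1, h0, h1⟩).trans
    (entropyLength_logitPath_le hr hx hy)

theorem proposition8p9 (r : ℕ) (hr : 2 ≤ r) (i : Fin r) :
    Tendsto (fun ε : ℝ => (rose r).entropyDiam (roseSlice r i ε)) (𝓝[>] (0 : ℝ)) (𝓝 0) := by
  -- The limit must be approached from above, since `logit` tends to infinity at 0 from the right.
  have h1 : Tendsto (fun ε : ℝ => 1 / 2 - fermi ε) (𝓝[>] 0) (𝓝[>] 0) := by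
    refine tendsto_nhdsWithin_iff.2 ⟨?_, ?_⟩
    · have h2 : Tendsto (fun ε : ℝ => 1 / 2 - fermi ε) (𝓝 0) (𝓝 (1 / 2 - fermi 0)) :=
        ((contDiff_fermi (n := 0)).continuous.tendsto 0).const_sub _
      have h3 : (1 / 2 : ℝ) - fermi 0 = 0 := by
        unfold fermi; norm_num
      rw [h3] at h2
      exact h2.mono_left nhdsWithin_le_nhds
    · filter_upwards [self_mem_nhdsWithin] with ε hε
      have := fermi_lt_half hε
      simpa using this
  have h2 : Tendsto (fun ε : ℝ => 2 * r / √(logit (1 / 2 - fermi ε) / 2)) (𝓝[>] 0) (𝓝 0) :=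
    (Real.tendsto_sqrt_atTop.comp ((tendsto_logit_zero.comp h1).atTop_div_const
      two_pos)).const_div_atTop _
  have h3 := ENNReal.tendsto_ofReal h2
  rw [ENNReal.ofReal_zero] at h3
  exact tendsto_of_tendsto_of_tendsto_of_le_of_le tendsto_const_nhds h3 (fun _ => zero_le)
    fun ε => entropyDiam_roseSlice_le hr i ε
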